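/- **Theorem 3.1.** Let $A$ be a complex unital primitive Banach algebra (that is, $\{0\}=\{a\in A : aA\subseteq L\}$ for some maximal left ideal $L$) and let $p\in A$ be a minimal idempotent, i.e. $p\neq 0$, $p^2=p$ and $pAp=\mathbb{C}p$. Let $\mathrm{soc}(A)$ be the socle of $A$ (the sum of its minimal left ideals, a two-sided ideal), let $L(Ap)$ be the algebra of bounded operators on the Banach space $Ap$, let $F_0(Ap)\subseteq L(Ap)$ be the ideal of finite rank operators, and let $\mathfrak{L}_r : A\to L(Ap)$, $\mathfrak{L}_r(a)=\widehat a$, $\widehat a(y)=ay$, be the left regular representation. An element $x$ of a ring with unit is Drazin invertible if there are an element $y$ of the ring (a Drazin inverse of $x$) and $k\in\mathbb{N}$ with $yxy=y$, $xy=yx$, $x^kyx=x^k$. An element $a\in A$ is B-Fredholm if its image in $A/\mathrm{soc}(A)$ is Drazin invertible. In that case its index is $\mathbf{i}(a)=\tau(aa_0-a_0a)$, where $a_0\in A$ is any element whose image in $A/\mathrm{soc}(A)$ is a Drazin inverse of the image of $a$ (the value does not depend on $a_0$), and $\tau$ is the trace on the socle, $$\tau(x)=\sum_{\lambda\in\sigma(x)}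 m(\lambda,x)\,\lambda \qquad (x\in\mathrm{soc}(A)),$$ $\sigma(x)$ being the spectrum of $x$ in $A$ and $m(\lambda,x)$, for $\lambda\ne 0$, the algebraic multiplicity of $\lambda$ for $x$, i.e. the dimension of $\{y\in Ap : (x-\lambda)^n y=0 \text{ for some } n\}$ (the term $\lambda=0$ contributes $0$). A B-Weyl element is a B-Fredholm element of index $0$. Assume that $\mathfrak{L}_r(A)$ is Drazin inverse closed in $L(Ap)$ (every element of $\mathfrak{L}_r(A)$ that is Drazin invertible in $L(Ap)$ is Drazin invertible in $\mathfrak{L}_r(A)$) and that $\mathfrak{L}_r(\mathrm{soc}(A))=F_0(Ap)$. Then an element $a\in A$ is a B-Weyl element if and only if $a=b+c$ with $b$ a Drazin invertible element of $A$ and $c\in\mathrm{soc}(A)$. -/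

import Mathlib

noncomputable section

namespace BFredholm

/-! ### Drazin invertibility -/

/-- `b` is a Drazin inverse of `a`: `bab = b`, `ab = ba` and `aᵏba = aᵏ` for some `k ∈ ℕ`. -/
def IsDrazinInverse {R : Type*} [Monoid R] (a b : R) : Prop :=
  b * a * b = b ∧ a * b = b * a ∧ ∃ k : ℕ, a ^ k * b * a = a ^ k

/-- `a` is Drazin invertible. -/
def IsDrazinInvertible {R : Type*} [Monoid R] (a : R) : Prop :=
  ∃ b : R, IsDrazinInverse a b

/-- A subalgebra `S` of `B` is Drazin inverse closed in `B` if every element of `S` that is Drazin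
invertible in `B` is Drazin invertible in `S`. -/
def IsDrazinInverseClosed {K B : Type*} [CommSemiring K] [Semiring B] [Algebra K B]
    (S : Subalgebra K B) : Prop :=
  ∀ x : S, IsDrazinInvertible (x : B) → IsDrazinInvertible x

/-! ### Primitive rings, the socle, minimal idempotents -/

/-- A unital ring is (left) primitive if `{0}` is a primitive ideal, that is
`{0} = {a | aR ⊆ L}` for some maximal left ideal `L` (`Ideal R` is the type of left ideals);
equivalently `{0}` is the annihilator of the simple left module `R ⧸ L`. -/
def IsPrimitiveRing (R : Type*) [Ring R] : Prop :=
  ∃ L : Ideal R, L.IsMaximal ∧ ∀ a : R, (∀ x : R, a * x ∈ L) → a = 0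

/-- The socle of a ring: the sum of its minimal left ideals. -/
def socle (R : Type*) [Ring R] : Ideal R :=
  sSup {I : Ideal R | IsAtom I}

/-- The socle is a two-sided ideal. -/
instance socle_isTwoSided (R : Type*) [Ring R] : (socle R).IsTwoSided where
  mul_mem_of_left {a} b ha := by
    have h : socle R ≤ Submodule.comap (LinearMap.toSpanSingleton R R b) (socle R) := by
      refine sSup_le fun I hI => ?_
      rw [← Submodule.map_le_iff_le_comap]
      have hI' : IsAtom I := hI
      rw [← isSimpleModule_iff_isAtom] at hI'
      let g : I →ₗ[R] R := (LinearMap.toSpanSingleton R R b).comp I.subtype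
      have hg : Submodule.map (LinearMap.toSpanSingleton R R b) I = LinearMap.range g := by
        rw [LinearMap.range_comp, Submodule.range_subtype]
      rw [hg]
      rcases LinearMap.injective_or_eq_zero g with hinj | h0
      · have : IsSimpleModule R (LinearMap.range g) :=
          IsSimpleModule.congr (LinearEquiv.ofInjective g hinj).symm
        exact le_sSup (isSimpleModule_iff_isAtom.mp this)
      · rw [h0, LinearMap.range_zero]
        exact bot_le
    exact h ha

/-- A minimal idempotent of a complex algebra `A`: a nonzero idempotent `p` with `pAp = ℂp`. -/
def IsMinimalIdempotent {A : Type*} [Ring A] [Algebra ℂ A] (p : A) : Prop :=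
  p ≠ 0 ∧ p * p = p ∧ ∀ x : A, ∃ z : ℂ, p * x * p = z • p

/-! ### The left regular representation on `Ap` -/

section Banach

variable {A : Type*} [NormedRing A] [NormedAlgebra ℂ A]

/-- The left ideal `Ap = {xp | x ∈ A}`, as a complex normed space. -/
abbrev Lideal (p : A) : Submodule ℂ A :=
  LinearMap.range (LinearMap.mulRight ℂ p)

/-- The operator `â : Ap → Ap`, `y ↦ ay`. -/
def hat (p a : A) : Lideal p →L[ℂ] Lideal p :=
  ((ContinuousLinearMap.mul ℂ A a).comp (Lideal p).subtypeL).codRestrict (Lideal p) (by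
    rintro ⟨_, x, rfl⟩
    exact ⟨a * x, by simp [mul_assoc]⟩)

@[simp] theorem coe_hat (p a : A) (y : Lideal p) : ((hat p a y : Lideal p) : A) = a * y := rfl

/-- The left regular representation `a ↦ â` of `A` on `Ap`, as an algebra homomorphism
`A → L(Ap)`. -/
def leftRegRep (p : A) : A →ₐ[ℂ] (Lideal p →L[ℂ] Lideal p) :=
  AlgHom.ofLinearMap
    { toFun := hat p
      map_add' := fun a b => by ext y; simp [add_mul]
      map_smul' := fun z a => by ext y; simp }
    (by ext y; simp)
    (fun a b => by ext y; simp [mul_assoc])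

/-- The set `F₀(X)` of bounded operators of finite rank on `X`. -/
def finiteRankOperators (X : Type*) [NormedAddCommGroup X] [NormedSpace ℂ X] : Set (X →L[ℂ] X) :=
  {T | FiniteDimensional ℂ (LinearMap.range (T : X →ₗ[ℂ] X))}

/-! ### The trace on the socle -/

/-- The algebraic multiplicity `m(z, a)` of `z` for an element `a` of the socle: the dimension of
the generalized eigenspace `{y ∈ Ap | ∃ n, (a - z)ⁿ y = 0}`. It is finite for `z ≠ 0`; the value at
`z = 0` plays no role in the trace. -/
def algMultiplicity (p : A) (z : ℂ) (a : A) : ℕ :=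
  Module.finrank ℂ
    (Module.End.maxGenEigenspace (leftRegRep p a : Lideal p →ₗ[ℂ] Lideal p) z)

/-- The trace `τ(a) = ∑_{z ∈ σ(a)} m(z, a) z` of an element `a` of the socle; `σ(a)` is the
spectrum of `a` in `A`, and the sum has finitely many nonzero terms. -/
def socleTrace (p a : A) : ℂ :=
  ∑ᶠ z ∈ spectrum ℂ a, (algMultiplicity p z a : ℂ) * z

end Banach

/-! ### B-Fredholm and B-Weyl elements -/

/-- `a` is B-Fredholm modulo the two-sided ideal `J` if its image in `R ⧸ J` is Drazin
invertible. -/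
def IsBFredholm {R : Type*} [Ring R] (J : Ideal R) [J.IsTwoSided] (a : R) : Prop :=
  IsDrazinInvertible (Ideal.Quotient.mk J a)

/-- `a₀` is a Drazin inverse of `a` modulo `J`. -/
def IsDrazinInverseMod {R : Type*} [Ring R] (J : Ideal R) [J.IsTwoSided] (a a₀ : R) : Prop :=
  IsDrazinInverse (Ideal.Quotient.mk J a) (Ideal.Quotient.mk J a₀)

theorem IsBFredholm.exists_inverseMod {R : Type*} [Ring R] {J : Ideal R} [J.IsTwoSided] {a : R}
    (ha : IsBFredholm J a) : ∃ a₀ : R, IsDrazinInverseMod J a a₀ := by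
  obtain ⟨b, hb⟩ := ha
  obtain ⟨a₀, rfl⟩ := Ideal.Quotient.mk_surjective b
  exact ⟨a₀, hb⟩

section Banach

variable {A : Type*} [NormedRing A] [NormedAlgebra ℂ A]

/-- The index `i(a) = τ(aa₀ - a₀a)` of a B-Fredholm element `a` modulo the socle, where `a₀` is a
Drazin inverse of `a` modulo the socle (some choice of it; the value does not depend on the
choice). -/
def index (p : A) {a : A} (ha : IsBFredholm (socle A) a) : ℂ :=
  socleTrace p (a * ha.exists_inverseMod.choose - ha.exists_inverseMod.choose * a)

/-- A B-Weyl element: a B-Fredholm element modulo the socle, of index `0`. -/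
def IsBWeyl (p a : A) : Prop :=
  ∃ ha : IsBFredholm (socle A) a, index p ha = 0

end Banach

end BFredholm

end

/-! The representation on `Ap` is faithful because `A` is primitive, and it carries the socle onto
the finite rank operators. So the socle inherits their properties: its elements are algebraic and
von Neumann regular, it has an additive trace that kills commutators `yx - xy` with `x` in the socle
and `y` in `A`, and idempotents of equal trace (that is, equal rank) are equivalent inside it.

If `b` has Drazin inverse `b'` and `c` lies in the socle, then `b'` is a Drazin inverse of `b + c`
modulo the socle, and the index is the trace of a commutator with `c`, hence `0`.

Conversely, let `y` be a Drazin inverse of `x` modulo the socle. The class of `xy` is idempotent and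
lifts to an idempotent `P`. Modulo the socle `x` is `S + N`, where `S = PxP` is invertible in the
corner `PAP` and `N = (1-P)x(1-P)` is nilpotent. Then `N` is algebraic, hence Drazin invertible.
Index zero says that the kernel and cokernel idempotents of `S` have equal trace; an equivalence `g`
between them makes `S + g` invertible in the corner (`exists_isInvertible_add_of_trace_eq_zero`), so
`S + g + N` is Drazin invertible and differs from `x` by an element of the socle. -/

open Polynomial

namespace BFredholm

/-! ### Drazin inverses, algebraic elements and lifting of idempotents. -/

section Drazin

variable {R : Type*} [Ring R]

theorem add_pow_succ_of_mul_eq_zero {a b : R} (hab : a * b = 0) (hba : b * a = 0) (n : ℕ) :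
    (a + b) ^ (n + 1) = a ^ (n + 1) + b ^ (n + 1) := by
  induction n with
  | zero => simp
  | succ n ih =>
    have h1 : a ^ (n + 1) * b = 0 := by rw [pow_succ, mul_assoc, hab, mul_zero]
    have h2 : b ^ (n + 1) * a = 0 := by rw [pow_succ, mul_assoc, hba, mul_zero]
    rw [pow_succ, ih, add_mul, mul_add, mul_add, h1, h2, add_zero, zero_add, ← pow_succ, ← pow_succ]

theorem IsDrazinInverse.pow_mul_mul_of_le {a a' : R} {k m : ℕ} (h : a ^ k * a' * a = a ^ k)
    (hkm : k ≤ m) : a ^ m * a' * a = a ^ m := by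
  obtain ⟨j, rfl⟩ := Nat.exists_eq_add_of_le' hkm
  rw [pow_add, mul_assoc (a ^ j), mul_assoc (a ^ j), h]

/-- The sum of two Drazin invertible elements with product zero in both orders is Drazin
invertible. -/
theorem IsDrazinInverse.add {a a' b b' : R} (ha : IsDrazinInverse a a') (hb : IsDrazinInverse b b')
    (hab : a * b = 0) (hba : b * a = 0) : IsDrazinInverse (a + b) (a' + b') := by
  obtain ⟨ha1, ha2, k, hak⟩ := ha
  obtain ⟨hb1, hb2, l, hbl⟩ := hb
  have ea : a' * a' * a = a' := by rw [mul_assoc, ← ha2, ← mul_assoc, ha1]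
  have ea' : a * (a' * a') = a' := by rw [← mul_assoc, ha2, ha1]
  have eb : b' * b' * b = b' := by rw [mul_assoc, ← hb2, ← mul_assoc, hb1]
  have eb' : b * (b' * b') = b' := by rw [← mul_assoc, hb2, hb1]
  have h1 : a' * b = 0 := by rw [← ea, mul_assoc, hab, mul_zero]
  have h2 : b * a' = 0 := by rw [← ea', ← mul_assoc, hba, zero_mul]
  have h3 : b' * a = 0 := by rw [← eb, mul_assoc, hba, mul_zero]
  have h4 : a * b' = 0 := by rw [← eb', ← mul_assoc, hab, zero_mul]
  refine ⟨?_, ?_, k + l + 1, ?_⟩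
  · have h7 : b' * b * a' = 0 := by rw [mul_assoc, h2, mul_zero]
    have h8 : a' * a * b' = 0 := by rw [mul_assoc, h4, mul_zero]
    simp only [add_mul, mul_add, ha1, hb1, h1, h3, h7, h8, add_zero, zero_add]
  · simp only [add_mul, mul_add, ha2, hb2, h1, h2, h3, h4, add_zero, zero_add]
  · have e1 : a ^ (k + l + 1) * b' = 0 := by rw [pow_succ, mul_assoc, h4, mul_zero]
    have e2 : b ^ (k + l + 1) * a' = 0 := by rw [pow_succ, mul_assoc, h2, mul_zero]
    have f1 : a ^ (k + l + 1) * a' * a = a ^ (k + l + 1) :=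
      IsDrazinInverse.pow_mul_mul_of_le hak (by omega)
    have f2 : b ^ (k + l + 1) * b' * b = b ^ (k + l + 1) :=
      IsDrazinInverse.pow_mul_mul_of_le hbl (by omega)
    have e3 : a ^ (k + l + 1) * a' * b = 0 := by rw [mul_assoc, h1, mul_zero]
    have e4 : b ^ (k + l + 1) * b' * a = 0 := by rw [mul_assoc, h3, mul_zero]
    rw [add_pow_succ_of_mul_eq_zero hab hba]
    simp only [add_mul, mul_add, e1, e2, e3, e4, f1, f2, add_zero, zero_add]

theorem IsDrazinInverse.map {S : Type*} [Ring S] (f : R →+* S) {a b : R}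
    (h : IsDrazinInverse a b) : IsDrazinInverse (f a) (f b) := by
  obtain ⟨h1, h2, k, h3⟩ := h
  exact ⟨by rw [← map_mul, ← map_mul, h1], by rw [← map_mul, h2, map_mul],
    k, by rw [← map_pow, ← map_mul, ← map_mul, h3]⟩

/-- Drazin inverses are unique. -/
theorem IsDrazinInverse.unique {a b c : R} (hb : IsDrazinInverse a b) (hc : IsDrazinInverse a c) :
    b = c := by
  obtain ⟨hb1, hb2, k, hbk⟩ := hb
  obtain ⟨hc1, hc2, l, hcl⟩ := hc
  have hb3 := IsDrazinInverse.pow_mul_mul_of_le hbk (Nat.le_add_right k l)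
  have hc3 := IsDrazinInverse.pow_mul_mul_of_le hcl (Nat.le_add_left l k)
  generalize k + l = n at hb3 hc3
  have hab : Commute a b := hb2
  have hac : Commute a c := hc2
  have idem : ∀ x, x * a * x = x → ∀ m : ℕ, (a * x) ^ (m + 1) = a * x := by
    intro x hx m
    exact IsIdempotentElem.pow_succ_eq m (show a * x * (a * x) = a * x by
      rw [mul_assoc, ← mul_assoc x, hx])
  have eb : a * b = a ^ n * b ^ n * (a * b) := by
    rw [← hab.mul_pow, ← pow_succ, idem b hb1]
  have ec : a * c = (a * c) * (c ^ n * a ^ n) := by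
    rw [(hac.symm.pow_pow n n).eq, ← hac.mul_pow, ← pow_succ', idem c hc1]
  have hb4 : (a * b) * a ^ n = a ^ n := by
    rw [(((Commute.refl a).mul_left hab.symm).pow_right n).eq, hab.eq, ← mul_assoc, hb3]
  have hc4 : a ^ n * (a * c) = a ^ n := by rw [hac.eq, ← mul_assoc, hc3]
  -- The idempotents `ab` and `ac` both fix `aⁿ`. As `ab` is a multiple of `aⁿ`, it absorbs `ac`; as
  -- `ac` is one too, it absorbs `ab`. Both therefore equal `ab * ac`.
  have key : a * b = a * c := by
    calc a * b = b ^ n * a ^ n * (a * b) := by rw [← (hab.pow_pow n n).eq]; exact eb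
      _ = b ^ n * (a ^ n * (a * c)) * (a * b) := by rw [hc4]
      _ = (b ^ n * a ^ n * (a * b)) * (a * c) := by
          have : a ^ n * (a * c) * (a * b) = a ^ n * (a * b) * (a * c) := by
            rw [hc4, hab.eq, ← mul_assoc (a ^ n), hb3, hc4]
          rw [mul_assoc (b ^ n), this]; simp only [mul_assoc]
      _ = (a * b) * (a * c) := by rw [← (hab.pow_pow n n).eq, ← eb]
      _ = (a * b) * ((a * c) * (c ^ n * a ^ n)) := by rw [← ec]
      _ = (a * b) * (a ^ n * (c ^ n * (a * c))) := by
          congr 1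
          rw [(hac.symm.pow_pow n n).eq, ← hac.mul_pow, ← pow_succ', pow_succ, hac.mul_pow,
            mul_assoc]
      _ = a ^ n * (c ^ n * (a * c)) := by rw [← mul_assoc, hb4]
      _ = a * c := by rw [← mul_assoc, ← hac.mul_pow, ← pow_succ, idem c hc1]
  calc b = b * (a * b) := by rw [← mul_assoc, hb1]
    _ = b * a * c := by rw [key, mul_assoc]
    _ = a * c * c := by rw [← hb2, key]
    _ = c := by rw [hac.eq, hc1]

variable [Algebra ℂ R]

/-- Algebraic elements are Drazin invertible; the Drazin inverse is a polynomial in the element. -/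
theorem isDrazinInvertible_of_isAlgebraic {x : R} (hx : IsAlgebraic ℂ x) :
    IsDrazinInvertible x := by
  obtain ⟨m, hm0, hm⟩ := hx
  obtain ⟨r, hr, hdvd⟩ := exists_eq_pow_rootMultiplicity_mul_and_not_dvd m hm0 0
  generalize rootMultiplicity 0 m = i at hr
  rw [C_0, sub_zero] at hr hdvd
  have hc : r.coeff 0 ≠ 0 := fun h => hdvd (X_dvd_iff.2 h)
  -- Write `m = Xⁱ r` with `r(0) ≠ 0`. Solving `m(x) = 0` for the lowest term gives `xⁱ = xⁱ⁺¹ w`.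
  -- Iterating `i + 1` times shows that `xⁱ wⁱ⁺¹` is the Drazin inverse.
  set w : R := aeval x (-(C (r.coeff 0)⁻¹ * r.divX)) with hw
  have hxw : Commute x w := by
    have := (Commute.all (X : ℂ[X]) (-(C (r.coeff 0)⁻¹ * r.divX))).map (aeval x)
    rwa [aeval_X] at this
  have hpoly : X ^ i - X ^ (i + 1) * (-(C (r.coeff 0)⁻¹ * r.divX)) = C (r.coeff 0)⁻¹ * m := by
    have h1 : C (r.coeff 0)⁻¹ * C (r.coeff 0) = 1 := by
      rw [← C_mul, inv_mul_cancel₀ hc, C_1]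
    have h2 := divX_mul_X_add r
    rw [hr]
    linear_combination (X ^ i * C (r.coeff 0)⁻¹) * h2 - X ^ i * h1
  have hi : x ^ i = x ^ (i + 1) * w := by
    have := congrArg (aeval x) hpoly
    rw [map_mul, hm, mul_zero, map_sub, map_mul, map_pow, map_pow, aeval_X, sub_eq_zero] at this
    exact this
  have hij : ∀ j, x ^ i = x ^ (i + j) * w ^ j := by
    intro j
    induction j with
    | zero => simp
    | succ j ih =>
      calc x ^ i = x ^ (i + j) * w ^ j := ih
        _ = x ^ j * x ^ i * w ^ j := by rw [← pow_add, add_comm]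
        _ = x ^ j * (x ^ (i + 1) * w) * w ^ j := by rw [← hi]
        _ = x ^ (i + (j + 1)) * w ^ (j + 1) := by
          rw [← mul_assoc, ← pow_add, mul_assoc, ← pow_succ']; congr 2; omega
  have hxw' : Commute x (w ^ (i + 1)) := hxw.pow_right _
  have hcx : Commute x (x ^ i * w ^ (i + 1)) := ((Commute.refl x).pow_right i).mul_right hxw'
  have hkey : x ^ i * (x * (x ^ i * w ^ (i + 1))) = x ^ i := by
    rw [← mul_assoc x, ← pow_succ', ← mul_assoc, ← pow_add, ← hij]
  refine ⟨x ^ i * w ^ (i + 1), ?_, hcx, i, ?_⟩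
  · have hc := (hxw'.pow_left i).eq
    calc x ^ i * w ^ (i + 1) * x * (x ^ i * w ^ (i + 1))
        = w ^ (i + 1) * (x ^ i * (x * (x ^ i * w ^ (i + 1)))) := by
          rw [hc]; simp only [mul_assoc]
      _ = x ^ i * w ^ (i + 1) := by rw [hkey, hc]
  · rw [mul_assoc, ← hcx.eq, hkey]

/-- Idempotents lift along a ring homomorphism with algebraic kernel. -/
theorem exists_idempotent_lift {Q : Type*} [Ring Q] (q : R →+* Q)
    (halg : ∀ x, q x = 0 → IsAlgebraic ℂ x) (x : R) (hx : q x * q x = q x) :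
    ∃ P : R, P * P = P ∧ q P = q x := by
  obtain ⟨m, hm0, hm⟩ := halg (x * x - x) (by rw [map_sub, map_mul, hx, sub_self])
  -- The factors `X` and `X - 1` force `0` and `1` to be roots of `n`. With `n = (X - 1)ʲ r`, the
  -- Bézout term `v * r` is idempotent modulo `n`, with value `0` at `0` and `1` at `1`. Hence it is
  -- congruent to `X` modulo `X² - X`, and its value at `x` lifts `q x`.
  set n : ℂ[X] := X * ((X - C 1) * m.comp (X * X - X)) with hn
  have hn0 : n ≠ 0 := by
    refine mul_ne_zero X_ne_zero (mul_ne_zero (X_sub_C_ne_zero 1) fun h => ?_)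
    rcases comp_eq_zero_iff.1 h with h | ⟨-, h⟩
    · exact hm0 h
    · have := congrArg (fun p => coeff p 1) h
      simp [coeff_X] at this
  have hnx : aeval x n = 0 := by
    have : aeval x (X * X - X : ℂ[X]) = x * x - x := by simp
    rw [hn, map_mul, map_mul, aeval_comp, this, hm, mul_zero, mul_zero]
  obtain ⟨r, hr, hdvd⟩ := exists_eq_pow_rootMultiplicity_mul_and_not_dvd n hn0 1
  generalize rootMultiplicity 1 n = j at hr
  have hj : j ≠ 0 := by
    rintro rfl
    rw [pow_zero, one_mul] at hr
    exact hdvd ⟨X * m.comp (X * X - X), by rw [← hr, hn]; ring⟩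
  have hr0 : r.eval 0 = 0 := by
    have := congrArg (eval 0) hr
    rw [hn] at this
    simpa using this
  have hcop : IsCoprime ((X - C 1) ^ j) r :=
    ((irreducible_X_sub_C (1 : ℂ)).coprime_iff_not_dvd.2 hdvd).pow_left
  obtain ⟨u, v, huv⟩ := hcop
  have h1 : (v * r).eval 1 = 1 := by
    have := congrArg (eval 1) huv
    simpa [hj] using this
  have hX : X ∣ v * r - X := by
    rw [X_dvd_iff, coeff_zero_eq_eval_zero]; simp [hr0]
  have hX1 : X - C 1 ∣ v * r - X := by
    rw [dvd_iff_isRoot]; simpa [IsRoot, sub_eq_zero] using h1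
  have hcop' : IsCoprime (X : ℂ[X]) (X - C 1) := ⟨1, -1, by rw [C_1]; ring⟩
  obtain ⟨s, hs⟩ := hcop'.mul_dvd hX hX1
  refine ⟨aeval x (v * r), ?_, ?_⟩
  · have : (v * r) * (v * r) - v * r = -(u * v) * n := by
      rw [hr]; linear_combination (v * r) * huv
    rw [← sub_eq_zero, ← map_mul, ← map_sub, this, map_mul, hnx, mul_zero]
  · have : v * r = X + (X * X - X) * s := by rw [C_1] at hs; linear_combination hs
    rw [this]
    simp [hx]

end Drazin

end BFredholm

namespace BFredholm

/-! ### Index zero in a corner: an abstract Fedosov argument. -/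

section Corner

variable {R Q : Type*} [Ring R] [Ring Q]

/-- In the corner `PRP`, an element that is invertible modulo a von Neumann regular ideal is von
Neumann regular, with an inner inverse congruent to the given inverse. -/
theorem exists_inner_inverse_of_isInvertible_mod (q : R →+* Q)
    (hreg : ∀ x, q x = 0 → ∃ z, x * z * x = x) {P S V : R} (hP : P * P = P)
    (hPS : P * S = S) (hSP : S * P = S) (hPV : P * V = V) (hVP : V * P = V)
    (hSV : q (S * V) = q P) :
    ∃ U : R, P * U = U ∧ U * P = U ∧ S * U * S = S ∧ q U = q V := by
  obtain ⟨z, hz⟩ := hreg (S - S * V * S) (by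
    rw [map_sub, map_mul, hSV, ← map_mul, hPS, sub_self])
  have e1 : S * (P - V * S) = S - S * V * S := by rw [mul_sub, hSP, mul_assoc]
  have e2 : (P - S * V) * S = S - S * V * S := by rw [sub_mul, hPS]
  have e3 : P * (P - V * S) = P - V * S := by rw [mul_sub, hP, ← mul_assoc, hPV]
  have e4 : (P - S * V) * P = P - S * V := by rw [sub_mul, hP, mul_assoc, hVP]
  -- With `D = S - SVS` the defect of `V`, the correction contributes `D z D = D` to `SUS`.
  refine ⟨V + (P - V * S) * z * (P - S * V), ?_, ?_, ?_, ?_⟩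
  · rw [mul_add, hPV, ← mul_assoc, ← mul_assoc, e3]
  · rw [add_mul, hVP, mul_assoc, e4]
  · have : S * (V + (P - V * S) * z * (P - S * V)) * S =
        S * V * S + (S * (P - V * S)) * z * ((P - S * V) * S) := by noncomm_ring
    rw [this, e1, e2, hz, add_sub_cancel]
  · rw [map_add, map_mul, map_sub, hSV, sub_self, mul_zero, add_zero]

/-- A Fedosov-type statement in the corner `PRP`: an element that is invertible modulo a von Neumann
regular ideal and whose commutator with an inverse modulo the ideal has trace zero becomes
invertible after adding an element of the ideal. -/
theorem exists_isInvertible_add_of_trace_eq_zero (q : R →+* Q) (τ : R → ℂ)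
    (hreg : ∀ x, q x = 0 → ∃ z, x * z * x = x)
    (hadd : ∀ x y, q x = 0 → q y = 0 → τ (x + y) = τ x + τ y)
    (hcomm : ∀ x y, q x = 0 → τ (y * x - x * y) = 0)
    (hequiv : ∀ e e', q e = 0 → q e' = 0 → e * e = e → e' * e' = e' → τ e = τ e' →
      ∃ g w, g * w = e' ∧ w * g = e)
    {P S V : R} (hP : P * P = P)
    (hPS : P * S = S) (hSP : S * P = S) (hPV : P * V = V) (hVP : V * P = V)
    (hSV : q (S * V) = q P) (hVS : q (V * S) = q P) (hτ : τ (S * V - V * S) = 0) :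
    ∃ g W : R, q g = 0 ∧ P * g = g ∧ g * P = g ∧ P * W = W ∧ W * P = W ∧
      (S + g) * W = P ∧ W * (S + g) = P := by
  obtain ⟨U, hPU, hUP, hSUS, hqU⟩ :=
    exists_inner_inverse_of_isInvertible_mod q hreg hP hPS hSP hPV hVP hSV
  have hqUV : q (U - V) = 0 := by rw [map_sub, hqU, sub_self]
  have hqE : q (P - U * S) = 0 := by rw [map_sub, map_mul, hqU, ← map_mul, hVS, sub_self]
  have hqE' : q (P - S * U) = 0 := by rw [map_sub, map_mul, hqU, ← map_mul, hSV, sub_self]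
  have hSE : S * (P - U * S) = 0 := by rw [mul_sub, hSP, ← mul_assoc, hSUS, sub_self]
  have hES : (P - S * U) * S = 0 := by rw [sub_mul, hPS, hSUS, sub_self]
  have hEP : (P - U * S) * P = P - U * S := by rw [sub_mul, hP, mul_assoc, hSP]
  have hPE : P * (P - U * S) = P - U * S := by rw [mul_sub, hP, ← mul_assoc, hPU]
  have hEP' : (P - S * U) * P = P - S * U := by rw [sub_mul, hP, mul_assoc, hUP]
  have hPE' : P * (P - S * U) = P - S * U := by rw [mul_sub, hP, ← mul_assoc, hPS]
  have hEE : (P - U * S) * (P - U * S) = P - U * S := by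
    nth_rewrite 1 [sub_mul]
    rw [hPE, mul_assoc, hSE, mul_zero, sub_zero]
  have hEE' : (P - S * U) * (P - S * U) = P - S * U := by
    nth_rewrite 1 [mul_sub]
    rw [hEP', ← mul_assoc, hES, zero_mul, sub_zero]
  have hqc : q (S * V - V * S) = 0 := by rw [map_sub, hSV, hVS, sub_self]
  have hqd : q (S * (U - V) - (U - V) * S) = 0 := by
    rw [map_sub, map_mul, map_mul, hqUV, mul_zero, zero_mul, sub_self]
  have hττ : τ (P - U * S) = τ (P - S * U) := by
    -- The two traces differ by that of `SU - US`, which is the given commutator plus one with `U -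
    -- V` in the ideal.
    have : P - U * S = (P - S * U) + ((S * V - V * S) + (S * (U - V) - (U - V) * S)) := by
      noncomm_ring
    rw [this, hadd _ _ hqE' (by rw [map_add, hqc, hqd, add_zero]), hadd _ _ hqc hqd, hτ,
      hcomm _ _ hqUV, add_zero, add_zero]
  -- `S` is inverted by `USU` between the complements of `E = P - US` and `E' = P - SU`; `g` will
  -- supply the missing block from `E` to `E'`.
  obtain ⟨g, w, hgw, hwg⟩ := hequiv _ _ hqE hqE' hEE hEE' hττ
  have hUE : (U * S * U) * (P - S * U) = 0 := by
    have : U * S * U * (P - S * U) = U * S * (U * P) - U * (S * U * S) * U := by noncomm_ring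
    rw [this, hUP, hSUS, sub_self]
  have hEU : (P - U * S) * (U * S * U) = 0 := by
    have : (P - U * S) * (U * S * U) = (P * U) * S * U - U * (S * U * S) * U := by noncomm_ring
    rw [this, hPU, hSUS, sub_self]
  have hSU : S * (U * S * U) = P - (P - S * U) := by
    rw [← mul_assoc, ← mul_assoc, hSUS, sub_sub_cancel]
  have hUS : (U * S * U) * S = P - (P - U * S) := by
    rw [mul_assoc, mul_assoc, ← mul_assoc S, hSUS, sub_sub_cancel]
  have hPUSU : P * (U * S * U) = U * S * U := by rw [← mul_assoc, ← mul_assoc, hPU]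
  have hUSUP : (U * S * U) * P = U * S * U := by rw [mul_assoc, hUP]
  generalize U * S * U = W at *
  generalize P - U * S = E at *
  generalize P - S * U = E' at *
  have hg : E' * g * E = g * w * g * w * g := by rw [← hgw, ← hwg]; noncomm_ring
  -- Cutting `g` and `w` down by `E` and `E'` keeps them mutually inverse and kills the cross terms
  -- with `S` and `W`.
  have hgw' : (E' * g * E) * (E * w * E') = E' := by
    have : (E' * g * E) * (E * w * E') = E' * (g * (E * E) * w) * E' := by noncomm_ring
    rw [this, hEE, ← hwg]
    have : g * (w * g) * w = (g * w) * (g * w) := by noncomm_ring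
    rw [this, hgw, hEE', hEE', hEE']
  have hwg' : (E * w * E') * (E' * g * E) = E := by
    have : (E * w * E') * (E' * g * E) = E * (w * (E' * E') * g) * E := by noncomm_ring
    rw [this, hEE', ← hgw]
    have : w * (g * w) * g = (w * g) * (w * g) := by noncomm_ring
    rw [this, hwg, hEE, hEE, hEE]
  refine ⟨E' * g * E, W + E * w * E', by rw [map_mul, hqE, mul_zero], ?_, ?_, ?_, ?_, ?_, ?_⟩
  · rw [← mul_assoc, ← mul_assoc, hPE']
  · rw [mul_assoc, hEP]
  · rw [mul_add, hPUSU, ← mul_assoc, ← mul_assoc, hPE]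
  · rw [add_mul, hUSUP, mul_assoc, hEP']
  · have : (S + E' * g * E) * (W + E * w * E') =
        S * W + (S * E) * w * E' + E' * g * (E * W) + (E' * g * E) * (E * w * E') := by
      noncomm_ring
    rw [this, hSU, hSE, hEU, hgw']
    simp
  · have : (W + E * w * E') * (S + E' * g * E) =
        W * S + (W * E') * g * E + E * w * (E' * S) + (E * w * E') * (E' * g * E) := by
      noncomm_ring
    rw [this, hUS, hUE, hES, hwg']
    simp

/-- If `x` has a Drazin inverse `y` modulo a von Neumann regular, algebraic ideal carrying a trace
that classifies idempotents, and if the commutator of `x` and `y` has trace zero, then `x` is the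
sum of a Drazin invertible element and an element of the ideal. -/
theorem exists_isDrazinInvertible_add_of_trace_eq_zero [Algebra ℂ R] (q : R →+* Q) (τ : R → ℂ)
    (halg : ∀ x, q x = 0 → IsAlgebraic ℂ x)
    (hreg : ∀ x, q x = 0 → ∃ z, x * z * x = x)
    (hadd : ∀ x y, q x = 0 → q y = 0 → τ (x + y) = τ x + τ y)
    (hcomm : ∀ x y, q x = 0 → τ (y * x - x * y) = 0)
    (hequiv : ∀ e e', q e = 0 → q e' = 0 → e * e = e → e' * e' = e' → τ e = τ e' →
      ∃ g w, g * w = e' ∧ w * g = e)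
    {x y : R} (hxy : IsDrazinInverse (q x) (q y)) (hτ : τ (x * y - y * x) = 0) :
    ∃ b c : R, IsDrazinInvertible b ∧ q c = 0 ∧ x = b + c := by
  obtain ⟨h1, h2, k, hk⟩ := hxy
  obtain ⟨P, hP, hqP⟩ := exists_idempotent_lift q halg (x * y) (by
    rw [map_mul, mul_assoc, ← mul_assoc (q y), h1])
  rw [map_mul] at hqP
  have hqPx : q P * q x = q x * q P := by rw [hqP, mul_assoc, h2]
  have hqPy : q P * q y = q y := by rw [hqP, h2, h1]
  have hqyP : q y * q P = q y := by rw [hqP, ← mul_assoc, h1]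
  have hqPP : q P * q P = q P := by rw [← map_mul, hP]
  have l1 : ∀ z, P * (P * z) = P * z := fun z => by rw [← mul_assoc, hP]
  -- Since `q P` commutes with `q x` and fixes `q y`, the off-diagonal blocks of `x` and the
  -- difference `y - PyP` lie in the kernel of `q`.
  set S := P * x * P with hS
  set V := P * y * P with hV
  set N := (1 - P) * x * (1 - P) with hN
  have hPS : P * S = S := by simp only [hS, mul_assoc, l1]
  have hSP : S * P = S := by simp only [hS, mul_assoc, hP]
  have hPV : P * V = V := by simp only [hV, mul_assoc, l1]
  have hVP : V * P = V := by simp only [hV, mul_assoc, hP]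
  have hPN : P * N = 0 := by
    rw [hN, ← mul_assoc, ← mul_assoc, mul_sub P, mul_one, hP, sub_self, zero_mul, zero_mul]
  have hNP : N * P = 0 := by rw [hN, mul_assoc, sub_mul 1 P P, one_mul, hP, sub_self, mul_zero]
  have hqS : q S = q P * q x := by rw [hS, map_mul, map_mul, mul_assoc, ← hqPx, ← mul_assoc, hqPP]
  have hqV : q V = q y := by rw [hV, map_mul, map_mul, hqPy, hqyP]
  have hqN : q N = (1 - q P) * q x := by
    have : (1 - q P) * q x * (1 - q P) = (1 - q P) * q x - (q x * q P - q P * (q x * q P)) := by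
      noncomm_ring
    rw [hN, map_mul, map_mul, map_sub, map_one, this, ← hqPx, ← mul_assoc, hqPP, sub_self, sub_zero]
  have hSV : q (S * V) = q P := by rw [map_mul, hqS, hqV, mul_assoc, ← hqP, hqPP]
  have hVS : q (V * S) = q P := by rw [map_mul, hqS, hqV, ← mul_assoc, hqyP, ← h2, hqP]
  have hf : q (x - S - N) = 0 := by rw [map_sub, map_sub, hqS, hqN]; noncomm_ring
  have hd : q (y - V) = 0 := by rw [map_sub, hqV, sub_self]
  have hqker : ∀ a b, q b = 0 → q (a * b - b * a) = 0 := fun a b hb => by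
    rw [map_sub, map_mul, map_mul, hb, mul_zero, zero_mul, sub_self]
  have hτSV : τ (S * V - V * S) = 0 := by
    have hNV : N * V = 0 := by rw [← hPV, ← mul_assoc, hNP, zero_mul]
    have hVN : V * N = 0 := by rw [← hVP, mul_assoc, hPN, mul_zero]
    have hqSV : q (S * V - V * S) = 0 := by rw [map_sub, hSV, hVS, sub_self]
    -- Passing to `S` and `V` changes the commutator only by commutators with kernel elements, of
    -- trace zero, and by `NV - VN`, which vanishes.
    have e : x * y - y * x = (S * V - V * S) + ((x * (y - V) - (y - V) * x) +
        ((-V) * (x - S - N) - (x - S - N) * (-V))) + (N * V - V * N) := by noncomm_ring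
    rw [hNV, hVN, sub_zero, add_zero] at e
    rw [e, hadd _ _ hqSV (by rw [map_add, hqker _ _ hd, hqker _ _ hf, add_zero]),
      hadd _ _ (hqker _ _ hd) (hqker _ _ hf), hcomm _ _ hd, hcomm _ _ hf, add_zero,
      add_zero] at hτ
    exact hτ
  obtain ⟨g, W, hqg, hPg, hgP, hPW, hWP, hgW, hWg⟩ :=
    exists_isInvertible_add_of_trace_eq_zero q τ hreg hadd hcomm hequiv hP hPS hSP hPV hVP hSV hVS
      hτSV
  have hNalg : IsAlgebraic ℂ N := by
    -- `q P` acts as the identity on `(q x)ᵏ⁺¹`, so `Nᵏ⁺¹` lies in the kernel; `k + 1` keeps the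
    -- exponent positive when `k = 0`.
    refine IsAlgebraic.of_pow (Nat.succ_pos k) (halg _ ?_)
    have hc : Commute (1 - q P) (q x) := (Commute.one_left _).sub_left hqPx
    have hi : IsIdempotentElem (1 - q P) := IsIdempotentElem.one_sub hqPP
    have hPx : q P * q x ^ (k + 1) = q x ^ (k + 1) := by
      rw [(show Commute (q P) (q x) from hqPx).pow_right (k + 1), hqP, h2, ← mul_assoc,
        IsDrazinInverse.pow_mul_mul_of_le hk k.le_succ]
    rw [map_pow, hqN, hc.mul_pow, hi.pow_succ_eq, sub_mul, one_mul, hPx, sub_self]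
  obtain ⟨N', hN'⟩ := isDrazinInvertible_of_isAlgebraic hNalg
  refine ⟨(S + g) + N, x - S - N - g, ⟨W + N', IsDrazinInverse.add ⟨?_, ?_, 1, ?_⟩ hN' ?_ ?_⟩, ?_,
    by abel⟩
  · rw [hWg, hPW]
  · rw [hgW, hWg]
  · rw [pow_one, hgW, mul_add, hPS, hPg]
  · rw [← hSP, ← hgP, ← add_mul, mul_assoc, hPN, mul_zero]
  · rw [← hPS, ← hPg, ← mul_add, ← mul_assoc, hNP, zero_mul]
  · rw [map_sub, hf, hqg, sub_zero]

end Corner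

end BFredholm

noncomputable section

namespace BFredholm

/-! ### The trace of finite rank endomorphisms. -/

section FiniteRankTrace

open Module LinearMap

variable {V X : Type*} [AddCommGroup V] [Module ℂ V] [AddCommGroup X] [Module ℂ X]

/-- The trace of an endomorphism of finite rank: the trace of its restriction to its range. -/
def finiteRankTrace (T : End ℂ X) : ℂ :=
  trace ℂ (range T) (T.restrict (p := range T) (q := range T) fun x _ => mem_range_self T x)

/-- The trace of an endomorphism that factors through a finite dimensional space. -/
theorem finiteRankTrace_comp [FiniteDimensional ℂ V] (g : V →ₗ[ℂ] X) (f : X →ₗ[ℂ] V) :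
    finiteRankTrace (g ∘ₗ f) = trace ℂ V (f ∘ₗ g) := by
  have : FiniteDimensional ℂ (range (g ∘ₗ f)) :=
    Submodule.finiteDimensional_of_le (range_comp_le_range f g)
  -- Between the two finite dimensional ranges the usual identity `tr(gf) = tr(fg)` applies, and the
  -- trace of `fg` on `V` is already seen on the range of `f`.
  let f' : range (g ∘ₗ f) →ₗ[ℂ] range f := (f.rangeRestrict).domRestrict _
  let g' : range f →ₗ[ℂ] range (g ∘ₗ f) :=
    g.restrict (by rintro _ ⟨x, rfl⟩; exact ⟨x, rfl⟩)
  have h1 : finiteRankTrace (g ∘ₗ f) = trace ℂ _ (g' ∘ₗ f') := rfl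
  rw [h1, trace_comp_comm']
  exact trace_restrict_eq_of_forall_mem (range f) (f ∘ₗ g) (fun x => mem_range_self f (g x))

/-- The trace of a finite rank endomorphism may be computed on any finite dimensional subspace
containing the range. -/
theorem finiteRankTrace_eq_trace_codRestrict (W : Submodule ℂ X) [FiniteDimensional ℂ W]
    (T : End ℂ X) (hT : ∀ x, T x ∈ W) :
    finiteRankTrace T = trace ℂ W ((T.codRestrict W hT) ∘ₗ W.subtype) :=
  finiteRankTrace_comp W.subtype (T.codRestrict W hT)

theorem finiteRankTrace_add (S T : End ℂ X) [FiniteDimensional ℂ (range S)]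
    [FiniteDimensional ℂ (range T)] :
    finiteRankTrace (S + T) = finiteRankTrace S + finiteRankTrace T := by
  have hS : ∀ x, S x ∈ range S ⊔ range T := fun x =>
    Submodule.mem_sup_left (mem_range_self S x)
  have hT : ∀ x, T x ∈ range S ⊔ range T := fun x =>
    Submodule.mem_sup_right (mem_range_self T x)
  rw [finiteRankTrace_eq_trace_codRestrict _ S hS, finiteRankTrace_eq_trace_codRestrict _ T hT,
    finiteRankTrace_eq_trace_codRestrict _ (S + T) fun x => add_mem (hS x) (hT x), ← map_add]
  rfl

/-- Both products factor through the range of `S`, where they induce the same endomorphism; `T` may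
have infinite rank. -/
theorem finiteRankTrace_mul_comm (S T : End ℂ X) [FiniteDimensional ℂ (range S)] :
    finiteRankTrace (S * T) = finiteRankTrace (T * S) :=
  (finiteRankTrace_comp (range S).subtype (S.rangeRestrict ∘ₗ T)).trans
    (finiteRankTrace_comp (T ∘ₗ (range S).subtype) S.rangeRestrict).symm

theorem finiteRankTrace_neg (T : End ℂ X) [FiniteDimensional ℂ (range T)] :
    finiteRankTrace (-T) = -finiteRankTrace T := by
  have hT : ∀ x, T x ∈ range T := fun x => mem_range_self T x
  rw [finiteRankTrace_eq_trace_codRestrict _ T hT,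
    finiteRankTrace_eq_trace_codRestrict _ (-T) fun x => neg_mem (hT x), ← map_neg]
  rfl

theorem finiteRankTrace_of_isIdempotentElem {T : End ℂ X} (hT : T * T = T)
    [FiniteDimensional ℂ (range T)] : finiteRankTrace T = finrank ℂ (range T) := by
  have : (T.restrict (p := range T) (q := range T) fun x _ => mem_range_self T x) =
      LinearMap.id := by
    ext ⟨_, x, rfl⟩
    exact congrArg (fun f => f x) hT
  rw [finiteRankTrace, this, trace_id]

/-- Generalized eigenvectors for nonzero eigenvalues lie in the range. -/
theorem maxGenEigenspace_le_range (T : End ℂ X) {z : ℂ} (hz : z ≠ 0) :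
    T.maxGenEigenspace z ≤ range T := by
  intro y hy
  obtain ⟨n, hn⟩ := (End.mem_maxGenEigenspace T z y).1 hy
  clear hy
  induction n generalizing y with
  | zero => simp_all
  | succ n ih =>
    rw [pow_succ] at hn
    have h := ih (y := (T - z • 1) y) hn
    have hy : y = z⁻¹ • (T y - (T - z • 1) y) := by simp [smul_smul, inv_mul_cancel₀ hz]
    rw [hy]
    exact Submodule.smul_mem _ _ (sub_mem (mem_range_self T y) h)

/-- The space is the direct sum of the generalized eigenspaces, and on each of them `T - z` is
nilpotent, hence of trace zero. -/
theorem trace_eq_sum_maxGenEigenspace [FiniteDimensional ℂ V] (T : End ℂ V)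
    (hfin : {z | T.maxGenEigenspace z ≠ ⊥}.Finite) :
    trace ℂ V T = ∑ z ∈ hfin.toFinset, (finrank ℂ (T.maxGenEigenspace z) : ℂ) * z := by
  classical
  have hds := DirectSum.isInternal_submodule_of_iSupIndep_of_iSup_eq_top
    T.independent_maxGenEigenspace T.iSup_maxGenEigenspace_eq_top
  have hmaps := fun z => T.mapsTo_maxGenEigenspace_of_comm (Commute.refl T) z
  rw [trace_eq_sum_trace_restrict' hds hfin hmaps]
  refine Finset.sum_congr rfl fun z _ => ?_
  have h := (isNilpotent_trace_of_isNilpotent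
    (T.isNilpotent_restrict_maxGenEigenspace_sub_algebraMap z)).eq_zero
  have e : (T - algebraMap ℂ (End ℂ V) z).restrict
      (T.mapsTo_maxGenEigenspace_of_comm (Algebra.mul_sub_algebraMap_commutes T z) z) =
      T.restrict (hmaps z) - z • 1 := by
    ext x; rfl
  rw [e, map_sub, map_smul, trace_one, sub_eq_zero] at h
  rw [h, smul_eq_mul, mul_comm]

/-- The trace of a finite rank endomorphism is the sum of its eigenvalues counted with algebraic
multiplicity. -/
theorem finsum_maxGenEigenspace_mul_eq_finiteRankTrace (T : End ℂ X)
    [FiniteDimensional ℂ (range T)] :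
    ∑ᶠ z : ℂ, (finrank ℂ (T.maxGenEigenspace z) : ℂ) * z = finiteRankTrace T := by
  set T' : End ℂ (range T) :=
    T.restrict (p := range T) (q := range T) fun x _ => mem_range_self T x with hT'
  have hfin : {z | T'.maxGenEigenspace z ≠ ⊥}.Finite :=
    WellFoundedGT.finite_ne_bot_of_iSupIndep T'.independent_maxGenEigenspace
  have hrank : ∀ z ≠ 0, finrank ℂ (T.maxGenEigenspace z) = finrank ℂ (T'.maxGenEigenspace z) := by
    intro z hz
    have h : T'.maxGenEigenspace z = (T.maxGenEigenspace z).comap (range T).subtype :=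
      End.genEigenspace_restrict T (range T) ⊤ z _
    rw [h]
    exact (Submodule.comapSubtypeEquivOfLe (maxGenEigenspace_le_range T hz)).finrank_eq.symm
  -- At `z = 0` the two dimensions may differ, but the factor `z` removes the term.
  have hterm : ∀ z, (finrank ℂ (T.maxGenEigenspace z) : ℂ) * z =
      (finrank ℂ (T'.maxGenEigenspace z) : ℂ) * z := by
    intro z
    rcases eq_or_ne z 0 with rfl | hz
    · simp
    · rw [hrank z hz]
  rw [finsum_congr hterm, finiteRankTrace, trace_eq_sum_maxGenEigenspace _ hfin]
  refine finsum_eq_sum_of_support_subset _ fun z hz => ?_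
  rw [Set.Finite.coe_toFinset]
  rintro (h : T'.maxGenEigenspace z = ⊥)
  rw [Function.mem_support, h, finrank_bot] at hz
  simp at hz

/-- `T` maps into its range, where the characteristic polynomial of the restriction vanishes by
Cayley–Hamilton; so `X` times that polynomial kills `T`. -/
theorem isAlgebraic_of_finiteDimensional_range (T : End ℂ X) [FiniteDimensional ℂ (range T)] :
    IsAlgebraic ℂ T := by
  set T' : End ℂ (range T) :=
    T.restrict (p := range T) (q := range T) fun x _ => mem_range_self T x with hT'
  have hpoly : ∀ (m : Polynomial ℂ) (y : range T),
      ((Polynomial.aeval T' m y : range T) : X) = Polynomial.aeval T m y := by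
    intro m
    induction m using Polynomial.induction_on' with
    | add a b ha hb => intro y; simp [ha, hb]
    | monomial n c =>
      intro y
      have : ((T' ^ n) y : X) = (T ^ n) y := by
        induction n generalizing y with
        | zero => rfl
        | succ n ih => rw [pow_succ, pow_succ]; exact ih (T' y)
      simp [Polynomial.aeval_monomial, this]
  refine ⟨T'.charpoly * Polynomial.X, mul_ne_zero T'.charpoly_monic.ne_zero Polynomial.X_ne_zero, ?_⟩
  ext x
  rw [map_mul, Polynomial.aeval_X]
  have h := hpoly T'.charpoly ⟨T x, mem_range_self T x⟩
  rw [aeval_self_charpoly] at h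
  exact h.symm

end FiniteRankTrace

end BFredholm

end

noncomputable section

namespace BFredholm

/-! ### Bounded finite rank operators: regularity and equivalence of projections. -/

section FiniteRankOperators

open Module

variable {X : Type*} [NormedAddCommGroup X] [NormedSpace ℂ X]

theorem mem_finiteRankOperators_of_forall_mem (W : Submodule ℂ X) [FiniteDimensional ℂ W]
    {T : X →L[ℂ] X} (hT : ∀ x, T x ∈ W) : T ∈ finiteRankOperators X :=
  Submodule.finiteDimensional_of_le (S₂ := W) (by rintro _ ⟨x, rfl⟩; exact hT x)

/-- Finite rank operators are von Neumann regular in the ring of finite rank operators. -/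
theorem exists_finiteRank_inner_inverse {T : X →L[ℂ] X} (hT : T ∈ finiteRankOperators X) :
    ∃ Z ∈ finiteRankOperators X, T * Z * T = T := by
  have : FiniteDimensional ℂ (LinearMap.range (T : X →ₗ[ℂ] X)) := hT
  obtain ⟨Q, hQ⟩ := Submodule.ClosedComplemented.of_finiteDimensional
    (LinearMap.range (T : X →ₗ[ℂ] X))
  obtain ⟨s, hs⟩ := (T : X →ₗ[ℂ] X).rangeRestrict.exists_rightInverse_of_surjective
    (LinearMap.range_rangeRestrict _)
  -- A bounded projection onto the range, followed by a linear section of `T`, which is continuous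
  -- because the range is finite dimensional.
  refine ⟨(LinearMap.toContinuousLinearMap s).comp Q,
    mem_finiteRankOperators_of_forall_mem (LinearMap.range s) fun x =>
      LinearMap.mem_range_self s (Q x), ?_⟩
  ext x
  have h1 : Q (T x) = ⟨T x, x, rfl⟩ := hQ ⟨T x, x, rfl⟩
  have h2 := congrArg Subtype.val (LinearMap.congr_fun hs ⟨T x, x, rfl⟩)
  change T (s (Q (T x))) = T x
  rw [h1]
  exact h2

/-- Finite rank projections of the same rank are Murray-von Neumann equivalent through finite rank
operators. -/
theorem exists_mul_eq_of_finrank_range_eq {E E' : X →L[ℂ] X} (hE : E ∈ finiteRankOperators X)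
    (hE' : E' ∈ finiteRankOperators X) (hEE : E * E = E) (hEE' : E' * E' = E')
    (h : finrank ℂ (LinearMap.range (E : X →ₗ[ℂ] X)) =
      finrank ℂ (LinearMap.range (E' : X →ₗ[ℂ] X))) :
    ∃ G ∈ finiteRankOperators X, ∃ W ∈ finiteRankOperators X, G * W = E' ∧ W * G = E := by
  have : FiniteDimensional ℂ (LinearMap.range (E : X →ₗ[ℂ] X)) := hE
  have : FiniteDimensional ℂ (LinearMap.range (E' : X →ₗ[ℂ] X)) := hE'
  let φ := LinearEquiv.ofFinrankEq _ _ h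
  let R : X →L[ℂ] LinearMap.range (E : X →ₗ[ℂ] X) := E.codRestrict _ fun x => ⟨x, rfl⟩
  let R' : X →L[ℂ] LinearMap.range (E' : X →ₗ[ℂ] X) := E'.codRestrict _ fun x => ⟨x, rfl⟩
  have hR : ∀ y : LinearMap.range (E : X →ₗ[ℂ] X), R y = y := by
    rintro ⟨_, x, rfl⟩
    exact Subtype.ext (DFunLike.congr_fun hEE x)
  have hR' : ∀ y : LinearMap.range (E' : X →ₗ[ℂ] X), R' y = y := by
    rintro ⟨_, x, rfl⟩
    exact Subtype.ext (DFunLike.congr_fun hEE' x)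
  refine ⟨(LinearMap.range (E' : X →ₗ[ℂ] X)).subtypeL.comp
      ((LinearMap.toContinuousLinearMap (φ : _ →ₗ[ℂ] _)).comp R),
    mem_finiteRankOperators_of_forall_mem _ fun x => (φ (R x)).2,
    (LinearMap.range (E : X →ₗ[ℂ] X)).subtypeL.comp
      ((LinearMap.toContinuousLinearMap (φ.symm : _ →ₗ[ℂ] _)).comp R'),
    mem_finiteRankOperators_of_forall_mem _ fun x => (φ.symm (R' x)).2, ?_, ?_⟩
  · ext x
    change ((φ (R (φ.symm (R' x) : X)) : LinearMap.range (E' : X →ₗ[ℂ] X)) : X) = E' x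
    rw [hR, LinearEquiv.apply_symm_apply]
    rfl
  · ext x
    change ((φ.symm (R' (φ (R x) : X)) : LinearMap.range (E : X →ₗ[ℂ] X)) : X) = E x
    rw [hR', LinearEquiv.symm_apply_apply]
    rfl

end FiniteRankOperators

/-! ### Transfer to the socle and the characterization of B-Weyl elements. -/

section LeftRegularRepresentation

open Module

variable {A : Type*} [NormedRing A] [NormedAlgebra ℂ A]

/-- The left regular representation of a primitive algebra on `Ap` is faithful. -/
theorem leftRegRep_injective (hA : IsPrimitiveRing A) {p : A} (hp : p ≠ 0) :
    Function.Injective (leftRegRep p) := by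
  rw [injective_iff_map_eq_zero]
  intro a ha
  obtain ⟨L, hL, hL0⟩ := hA
  have hap : ∀ x, a * (x * p) = 0 := fun x =>
    congrArg Subtype.val (DFunLike.congr_fun ha (⟨x * p, x, rfl⟩ : Lideal p))
  -- Maximality of `L` then gives `1 = y(px) + l` with `l ∈ L`. Since `a` kills `Ap`, `az = a(zyp)x
  -- + azl` lies in `L` for every `z`.
  obtain ⟨x, hx⟩ : ∃ x, p * x ∉ L := by
    by_contra! h
    exact hp (hL0 p h)
  obtain ⟨y, l, hl, hyl⟩ := hL.exists_inv hx
  refine hL0 a fun z => ?_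
  have : a * z = a * (z * y * p) * x + a * z * l := by
    calc a * z = a * z * (y * (p * x) + l) := by rw [hyl, mul_one]
      _ = _ := by noncomm_ring
  rw [this, hap, zero_mul, zero_add]
  exact L.mul_mem_left _ hl

/-- The left regular representation on `Ap`, with values in the linear endomorphisms. -/
def leftRegEnd (p : A) : A →ₐ[ℂ] End ℂ (Lideal p) :=
  AlgHom.ofLinearMap
    { toFun := fun a => (leftRegRep p a : Lideal p →ₗ[ℂ] Lideal p)
      map_add' := fun a b => by rw [map_add]; rfl
      map_smul' := fun z a => by rw [map_smul]; rfl }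
    (congrArg ContinuousLinearMap.toLinearMap (map_one (leftRegRep p)))
    (fun a b => congrArg ContinuousLinearMap.toLinearMap (map_mul (leftRegRep p) a b))

/-- The trace of an element represented by a finite rank operator is the trace of that operator. -/
theorem socleTrace_eq_finiteRankTrace (p x : A)
    [FiniteDimensional ℂ (LinearMap.range (leftRegEnd p x))] :
    socleTrace p x = finiteRankTrace (leftRegEnd p x) := by
  rw [← finsum_maxGenEigenspace_mul_eq_finiteRankTrace, socleTrace]
  classical
  refine finsum_congr fun z => ?_
  by_cases hz : z ∈ spectrum ℂ x
  · rw [finsum_eq_if, if_pos hz]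
    rfl
  -- Off the spectrum there are no generalized eigenvectors, so the sum may run over all of `ℂ`.
  · have hu : IsUnit (leftRegEnd p x - z • 1) := by
      have h := (spectrum.notMem_iff.1 hz).map (leftRegEnd p)
      rw [map_sub, AlgHom.commutes, Algebra.algebraMap_eq_smul_one] at h
      simpa using h.neg
    have hbot : (leftRegEnd p x).maxGenEigenspace z = ⊥ := by
      rw [eq_bot_iff]
      intro y hy
      obtain ⟨n, hn⟩ := (End.mem_maxGenEigenspace _ z y).1 hy
      have hinj := ((End.isUnit_iff _).1 (hu.pow n)).injective
      exact hinj (hn.trans (map_zero _).symm)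
    rw [finsum_eq_if, if_neg hz, hbot, finrank_bot, Nat.cast_zero, zero_mul]

variable {p : A}

theorem finiteDimensional_range_leftRegEnd
    (hsoc : leftRegRep p '' (socle A : Set A) = finiteRankOperators (Lideal p))
    {x : A} (hx : x ∈ socle A) : FiniteDimensional ℂ (LinearMap.range (leftRegEnd p x)) := by
  have : leftRegRep p x ∈ finiteRankOperators (Lideal p) := hsoc ▸ Set.mem_image_of_mem _ hx
  exact this

theorem socleTrace_add
    (hsoc : leftRegRep p '' (socle A : Set A) = finiteRankOperators (Lideal p))
    {x y : A} (hx : x ∈ socle A) (hy : y ∈ socle A) :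
    socleTrace p (x + y) = socleTrace p x + socleTrace p y := by
  have := finiteDimensional_range_leftRegEnd hsoc hx
  have := finiteDimensional_range_leftRegEnd hsoc hy
  have := finiteDimensional_range_leftRegEnd hsoc (add_mem hx hy)
  simp only [socleTrace_eq_finiteRankTrace, map_add, finiteRankTrace_add]

theorem socleTrace_mul_sub_mul
    (hsoc : leftRegRep p '' (socle A : Set A) = finiteRankOperators (Lideal p))
    {x : A} (hx : x ∈ socle A) (y : A) : socleTrace p (y * x - x * y) = 0 := by
  have hyx : y * x ∈ socle A := (socle A).mul_mem_left y hx
  have hxy : x * y ∈ socle A := (socle A).mul_mem_right y hx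
  have := finiteDimensional_range_leftRegEnd hsoc hx
  have := finiteDimensional_range_leftRegEnd hsoc hyx
  have := finiteDimensional_range_leftRegEnd hsoc hxy
  have := finiteDimensional_range_leftRegEnd hsoc (neg_mem hxy)
  rw [sub_eq_add_neg, socleTrace_add hsoc hyx (neg_mem hxy), socleTrace_eq_finiteRankTrace,
    socleTrace_eq_finiteRankTrace, map_neg, finiteRankTrace_neg, map_mul, map_mul,
    finiteRankTrace_mul_comm (leftRegEnd p x), add_neg_cancel]

/-- The index of a B-Fredholm element may be computed from any Drazin inverse modulo the socle. -/
theorem index_eq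
    (hsoc : leftRegRep p '' (socle A : Set A) = finiteRankOperators (Lideal p))
    {a a₀ : A} (ha : IsBFredholm (socle A) a) (ha₀ : IsDrazinInverseMod (socle A) a a₀) :
    index p ha = socleTrace p (a * a₀ - a₀ * a) := by
  have ha₁ := ha.exists_inverseMod.choose_spec
  rw [index]
  set a₁ := ha.exists_inverseMod.choose
  -- Uniqueness in the quotient makes the two commutators differ by one with a socle element, of
  -- trace zero.
  have hd : a₁ - a₀ ∈ socle A := Ideal.Quotient.eq.1 (IsDrazinInverse.unique ha₁ ha₀)
  have h : a * a₁ - a₁ * a = (a * a₀ - a₀ * a) + (a * (a₁ - a₀) - (a₁ - a₀) * a) := by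
    noncomm_ring
  have hc : a * a₀ - a₀ * a ∈ socle A :=
    Ideal.Quotient.eq.1 (by rw [map_mul, map_mul]; exact ha₀.2.1)
  rw [h, socleTrace_add hsoc hc
    (sub_mem ((socle A).mul_mem_left _ hd) ((socle A).mul_mem_right _ hd)),
    socleTrace_mul_sub_mul hsoc hd, add_zero]

/-- The characterization of B-Weyl elements needs only that the left regular representation on `Ap`
maps the socle onto the finite rank operators: Drazin inverses are constructed inside `A`, so
Drazin inverse closedness of the image does not enter. -/
theorem isBWeyl_iff_exists_isDrazinInvertible_add (hA : IsPrimitiveRing A) (hp : p ≠ 0)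
    (hsoc : leftRegRep p '' (socle A : Set A) = finiteRankOperators (Lideal p)) (a : A) :
    IsBWeyl p a ↔ ∃ b c : A, IsDrazinInvertible b ∧ c ∈ socle A ∧ a = b + c := by
  have hinj := leftRegRep_injective hA hp
  have hinj' : Function.Injective (leftRegEnd p) :=
    fun x y h => hinj (ContinuousLinearMap.coe_injective h)
  have hmem : ∀ {x}, x ∈ socle A → leftRegRep p x ∈ finiteRankOperators (Lideal p) :=
    fun hx => hsoc ▸ Set.mem_image_of_mem _ hx
  have hlift : ∀ T ∈ finiteRankOperators (Lideal p), ∃ x, leftRegRep p x = T := fun T hT => by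
    rw [← hsoc] at hT
    exact hT.imp fun _ h => h.2
  constructor
  · rintro ⟨ha, hindex⟩
    obtain ⟨a₀, ha₀⟩ := ha.exists_inverseMod
    rw [index_eq hsoc ha ha₀] at hindex
    simp only [← Ideal.Quotient.eq_zero_iff_mem]
    refine exists_isDrazinInvertible_add_of_trace_eq_zero (Ideal.Quotient.mk (socle A))
      (socleTrace p) ?_ ?_ ?_ ?_ ?_ ha₀ hindex <;> simp only [Ideal.Quotient.eq_zero_iff_mem]
    · intro x hx
      have := finiteDimensional_range_leftRegEnd hsoc hx
      exact (isAlgebraic_algHom_iff _ hinj').1 (isAlgebraic_of_finiteDimensional_range _)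
    · intro x hx
      obtain ⟨Z, hZ, hxZ⟩ := exists_finiteRank_inner_inverse (hmem hx)
      obtain ⟨z, rfl⟩ := hlift Z hZ
      exact ⟨z, hinj (by rw [map_mul, map_mul, hxZ])⟩
    · exact fun x y hx hy => socleTrace_add hsoc hx hy
    · exact fun x y hx => socleTrace_mul_sub_mul hsoc hx y
    · intro e e' he he' hee hee' hτ
      have := finiteDimensional_range_leftRegEnd hsoc he
      have := finiteDimensional_range_leftRegEnd hsoc he'
      -- The trace of an idempotent is its rank, so in characteristic zero equal traces mean equal
      -- ranks.
      rw [socleTrace_eq_finiteRankTrace, socleTrace_eq_finiteRankTrace,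
        finiteRankTrace_of_isIdempotentElem (by rw [← map_mul, hee]),
        finiteRankTrace_of_isIdempotentElem (by rw [← map_mul, hee']), Nat.cast_inj] at hτ
      obtain ⟨G, hG, W, hW, hGW, hWG⟩ := exists_mul_eq_of_finrank_range_eq (hmem he) (hmem he')
        (by rw [← map_mul, hee]) (by rw [← map_mul, hee']) hτ
      obtain ⟨g, rfl⟩ := hlift G hG
      obtain ⟨w, rfl⟩ := hlift W hW
      exact ⟨g, w, hinj (by rw [map_mul, hGW]), hinj (by rw [map_mul, hWG])⟩
  · rintro ⟨b, c, ⟨b', hb⟩, hc, rfl⟩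
    have hmod : IsDrazinInverseMod (socle A) (b + c) b' := by
      have : Ideal.Quotient.mk (socle A) (b + c) = Ideal.Quotient.mk (socle A) b := by
        rw [map_add, Ideal.Quotient.eq_zero_iff_mem.2 hc, add_zero]
      rw [IsDrazinInverseMod, this]
      exact hb.map _
    have ha : IsBFredholm (socle A) (b + c) := ⟨_, hmod⟩
    refine ⟨ha, ?_⟩
    have h : (b + c) * b' - b' * (b + c) = (-b') * c - c * (-b') := by
      rw [add_mul, mul_add, hb.2.1]
      noncomm_ring
    rw [index_eq hsoc ha hmod, h, socleTrace_mul_sub_mul hsoc hc]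

end LeftRegularRepresentation

end BFredholm

end

theorem theorem3p1 {A : Type*} [NormedRing A] [NormedAlgebra ℂ A] [CompleteSpace A]
    (hA : BFredholm.IsPrimitiveRing A)
    (p : A) (hp : BFredholm.IsMinimalIdempotent p)
    (hclosed : BFredholm.IsDrazinInverseClosed (BFredholm.leftRegRep p).range)
    (hsoc : BFredholm.leftRegRep p '' (BFredholm.socle A : Set A) =
      BFredholm.finiteRankOperators (BFredholm.Lideal p))
    (a : A) :
    BFredholm.IsBWeyl p a ↔
      ∃ b c : A, BFredholm.IsDrazinInvertible b ∧ c ∈ BFredholm.socle A ∧ a = b + c :=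
  BFredholm.isBWeyl_iff_exists_isDrazinInvertible_add hA hp.1 hsoc a
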